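/- Let $\mathcal D$ and $\mathcal S$ be finite sets of demand and supply classes, $\mathcal E\subseteq\mathcal D\times\mathcal S$ the set of matching pairs, and $\mathcal A\subseteq\mathcal D\times\mathcal S$ the set of arrival pairs. For $D\subseteq\mathcal D$ let $\mathcal S(D)=\{j:(i,j)\in\mathcal E\text{ for some }i\in D\}$, and let $\xi^D\in\mathbb R^{\mathcal D\cup\mathcal S}$ be the vector equal to $1$ on $D$, $-1$ on $\mathcal S(D)$ and $0$ elsewhere; let $\xi^0$ be $1$ on $\mathcal D$ and $-1$ on $\mathcal S$. Let $c(x)=\sum_k c_kx_k$ with all $c_k>0$. Let $\bar\delta\in(0,1)$ and, for $\delta\in[0,\bar\delta]$, let $A^\delta=(A^\delta(t))_{t\ge0}$ be i.i.d. sequences on a common probability space with values in $\{\mathbf 1^i+\mathbf 1^j:(i,j)\in\mathcal A\}$ and mean $\alpha^\delta$. Assume that, for a fixed nonempty $D\subsetneq\mathcal D$: (A1) $\xi^D\cdot\alpha^\delta=-\delta$ for all $\delta\in[0,\bar\delta]$, and there is $\underline\delta>0$ with $\xi^{D'}\cdot\alpha^\delta\le-\underline\delta$ for all nonempty $D'\subsetneq\mathcal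 D$, $D'\ne D$, and all $\delta\in[0,\bar\delta]$; (A2) $\mathsf E\|A^\delta(t)-A^0(t)\|\le b\delta$ for a constant $b$ and all $t$ and $\delta\in[0,\bar\delta]$; (A3) the bipartite graph $(\mathcal D\cup\mathcal S,\mathcal E)$ is connected, and there are $i_0\in\mathcal S(D)$, $j_0\in\mathcal D\setminus D$ and $p_I>0$ with $\mathsf P\{A^\delta_{i_0}(t)\ge1,\ A^\delta_{j_0}(t)\ge1\}\ge p_I$ for all $t$ and $\delta\in[0,\bar\delta]$. Define the effective cost $\bar c(w)=\min\{c(x):x\ge0,\ \xi^0\cdot x=0,\ \xi^D\cdot x=w\}$ for $w\in\mathbb R$, and put $\bar c_+=\min_{i\in D}c_i+\min_{j\in\mathcal S\setminus\mathcal S(D)}c_j$ and $\bar c_-=\min_{j\in\mathcal S(D)}c_j+\min_{i\in\mathcal D\setminus D}c_i$. For $\delta\in(0,\bar\delta]$ let $\Delta(t)=\delta+\xi^D\cdot A^\delta(t)$, with variance $\sigma_\Delta^2$. The workload relaxation is the controlled random walk $$\widehat W(t+1)=\widehat W(t)-\delta+\hat I(t)+\Delta(t+1),\qquad t\ge0,\quad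 \widehat W(0)=w\in\mathbb R,$$ where the control $\hat I$ is any nonanticipative process (randomization allowed) with values in $[0,\infty)$. Its optimal average cost is $$\hat\eta^*=\inf_{\hat I}\ \limsup_{N\to\infty}\frac1N\sum_{t=0}^{N-1}\mathsf E[\bar c(\widehat W(t))],$$ and its diffusion approximation is $$\hat\eta^{**}=\frac12\,\frac{\sigma_\Delta^2}{\delta}\,\bar c_-\log\Bigl(1+\frac{\bar c_+}{\bar c_-}\Bigr).$$ Then $\hat\eta^*\ge\hat\eta^{**}+O(1)$ uniformly in $\delta$: there is a constant $C\ge 0$, independent of $\delta$ and of the initial condition $w$, such that $\hat\eta^*\ge\hat\eta^{**}-C$ for every $\delta\in(0,\bar\delta]$ and every $w\in\mathbb R$. -/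

import Mathlib

open MeasureTheory ProbabilityTheory Filter
open scoped ENNReal

noncomputable section

namespace BipartiteMatching

/-! Buffers are indexed by `𝒟 ⊕ 𝒮`: `Sum.inl i` is demand class `i`, `Sum.inr j` is supply class `j`.
`E ⊆ 𝒟 × 𝒮` is the set of matching pairs, `𝒜 ⊆ 𝒟 × 𝒮` the set of arrival pairs. -/

/-- The bipartite matching graph on `𝒟 ∪ 𝒮` with edge set `E`. -/
def matchingGraph {𝒟 𝒮 : Type*} (E : Set (𝒟 × 𝒮)) : SimpleGraph (𝒟 ⊕ 𝒮) where
  Adj x y :=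
    (∃ i j, (i, j) ∈ E ∧ x = Sum.inl i ∧ y = Sum.inr j) ∨
    (∃ i j, (i, j) ∈ E ∧ x = Sum.inr j ∧ y = Sum.inl i)
  symm := ⟨by
    rintro x y (⟨i, j, h, hx, hy⟩ | ⟨i, j, h, hx, hy⟩)
    · exact Or.inr ⟨i, j, h, hy, hx⟩
    · exact Or.inl ⟨i, j, h, hy, hx⟩⟩
  loopless := ⟨by
    rintro x (⟨i, j, _, hx, hy⟩ | ⟨i, j, _, hx, hy⟩) <;> simp [hx] at hy⟩

/-- `𝒮(D)`: the supply classes that can be matched with some demand class in `D`. -/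
def supplyOf {𝒟 𝒮 : Type*} (E : Set (𝒟 × 𝒮)) (D : Set 𝒟) : Set 𝒮 :=
  {j | ∃ i ∈ D, (i, j) ∈ E}

open Classical in
/-- The workload vector `ξ^D`: `1` on `D`, `-1` on `𝒮(D)`, and `0` elsewhere. -/
def xi {𝒟 𝒮 : Type*} (E : Set (𝒟 × 𝒮)) (D : Set 𝒟) : 𝒟 ⊕ 𝒮 → ℝ
  | Sum.inl i => if i ∈ D then 1 else 0
  | Sum.inr j => if j ∈ supplyOf E D then -1 else 0

/-- The balance vector `ξ^0`: `1` on demand classes and `-1` on supply classes. -/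
def xi0 {𝒟 𝒮 : Type*} : 𝒟 ⊕ 𝒮 → ℝ
  | Sum.inl _ => 1
  | Sum.inr _ => -1

/-- The dot product `v · x`. -/
def dot {ι : Type*} [Fintype ι] (v x : ι → ℝ) : ℝ := ∑ k, v k * x k

open Classical in
/-- The possible arrival vectors `1^i + 1^j`, `(i, j) ∈ 𝒜`. -/
def arrivalSet {𝒟 𝒮 : Type*} [Fintype 𝒟] [Fintype 𝒮] (𝒜 : Set (𝒟 × 𝒮)) :
    Set (EuclideanSpace ℝ (𝒟 ⊕ 𝒮)) :=
  {a | ∃ i j, (i, j) ∈ 𝒜 ∧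
    a = EuclideanSpace.single (Sum.inl i) (1 : ℝ) + EuclideanSpace.single (Sum.inr j) (1 : ℝ)}

/-- An i.i.d. arrival process: one demand unit and one supply unit arrive in each slot. -/
structure IsArrivalProcess {𝒟 𝒮 Ω : Type*} [Fintype 𝒟] [Fintype 𝒮] [MeasurableSpace Ω]
    (P : Measure Ω) (𝒜 : Set (𝒟 × 𝒮)) (A : ℕ → Ω → EuclideanSpace ℝ (𝒟 ⊕ 𝒮)) : Prop where
  measurable : ∀ t, Measurable (A t)
  mem_arrivalSet : ∀ t, ∀ᵐ ω ∂P, A t ω ∈ arrivalSet 𝒜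
  indep : iIndepFun A P
  identDistrib : ∀ t, IdentDistrib (A t) (A 0) P P

/-- The mean arrival rate vector. -/
def meanArrival {𝒟 𝒮 Ω : Type*} [Fintype 𝒟] [Fintype 𝒮] [MeasurableSpace Ω]
    (P : Measure Ω) (A : ℕ → Ω → EuclideanSpace ℝ (𝒟 ⊕ 𝒮)) : EuclideanSpace ℝ (𝒟 ⊕ 𝒮) :=
  ∫ ω, A 0 ω ∂P

/-- The heavy-traffic condition: the load of `D` is `-δ`, all other proper nonempty sets of demand
classes have load bounded away from zero. -/
def AssumptionA1 {𝒟 𝒮 Ω : Type*} [Fintype 𝒟] [Fintype 𝒮] [MeasurableSpace Ω]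
    (P : Measure Ω) (E : Set (𝒟 × 𝒮)) (D : Set 𝒟) (δmax : ℝ)
    (A : ℝ → ℕ → Ω → EuclideanSpace ℝ (𝒟 ⊕ 𝒮)) : Prop :=
  (∀ δ ∈ Set.Icc 0 δmax, dot (xi E D) (meanArrival P (A δ)) = -δ) ∧
  ∃ δlow > 0, ∀ δ ∈ Set.Icc 0 δmax, ∀ D' : Set 𝒟, D'.Nonempty → D' ≠ Set.univ → D' ≠ D →
    dot (xi E D') (meanArrival P (A δ)) ≤ -δlow

/-- Continuity of the arrival processes at `δ = 0`, with linear rate. -/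
def AssumptionA2 {𝒟 𝒮 Ω : Type*} [Fintype 𝒟] [Fintype 𝒮] [MeasurableSpace Ω]
    (P : Measure Ω) (δmax : ℝ)
    (A : ℝ → ℕ → Ω → EuclideanSpace ℝ (𝒟 ⊕ 𝒮)) : Prop :=
  ∃ b : ℝ, ∀ δ ∈ Set.Icc 0 δmax, ∀ t, ∫ ω, ‖A δ t ω - A 0 t ω‖ ∂P ≤ b * δ

/-- The matching graph is connected, and with uniformly positive probability the arriving pair
consists of a supply class in `𝒮(D)` and a demand class outside `D`. -/
def AssumptionA3 {𝒟 𝒮 Ω : Type*} [Fintype 𝒟] [Fintype 𝒮] [MeasurableSpace Ω]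
    (P : Measure Ω) (E : Set (𝒟 × 𝒮)) (D : Set 𝒟) (δmax : ℝ)
    (A : ℝ → ℕ → Ω → EuclideanSpace ℝ (𝒟 ⊕ 𝒮)) : Prop :=
  (matchingGraph E).Connected ∧
  ∃ i₀ ∈ supplyOf E D, ∃ j₀ ∈ Dᶜ, ∃ pI : ℝ, 0 < pI ∧ ∀ δ ∈ Set.Icc 0 δmax, ∀ t,
    pI ≤ P.real {ω | 1 ≤ A δ t ω (Sum.inr i₀) ∧ 1 ≤ A δ t ω (Sum.inl j₀)}

/-- The effective cost `c̄(w)`: the least cost of a balanced nonnegative buffer vector with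
workload `w`. -/
def effectiveCost {𝒟 𝒮 : Type*} [Fintype 𝒟] [Fintype 𝒮] (E : Set (𝒟 × 𝒮)) (D : Set 𝒟)
    (c : 𝒟 ⊕ 𝒮 → ℝ) (w : ℝ) : ℝ :=
  sInf {v | ∃ x : 𝒟 ⊕ 𝒮 → ℝ, (∀ k, 0 ≤ x k) ∧ dot xi0 x = 0 ∧ dot (xi E D) x = w ∧ v = dot c x}

/-- `c̄₊ = min {c_i : i ∈ D} + min {c_j : j ∈ 𝒮(D)ᶜ}`. -/
def cPlus {𝒟 𝒮 : Type*} (E : Set (𝒟 × 𝒮)) (D : Set 𝒟) (c : 𝒟 ⊕ 𝒮 → ℝ) : ℝ :=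
  sInf ((fun i => c (Sum.inl i)) '' D) + sInf ((fun j => c (Sum.inr j)) '' (supplyOf E D)ᶜ)

/-- `c̄₋ = min {c_j : j ∈ 𝒮(D)} + min {c_i : i ∈ Dᶜ}`. -/
def cMinus {𝒟 𝒮 : Type*} (E : Set (𝒟 × 𝒮)) (D : Set 𝒟) (c : 𝒟 ⊕ 𝒮 → ℝ) : ℝ :=
  sInf ((fun j => c (Sum.inr j)) '' supplyOf E D) + sInf ((fun i => c (Sum.inl i)) '' Dᶜ)

/-- The zero-mean disturbance `Δ(t) = δ + ξ^D · A(t)`. -/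
def disturbance {𝒟 𝒮 Ω : Type*} [Fintype 𝒟] [Fintype 𝒮] (E : Set (𝒟 × 𝒮)) (D : Set 𝒟) (δ : ℝ)
    (A : ℕ → Ω → EuclideanSpace ℝ (𝒟 ⊕ 𝒮)) (t : ℕ) (ω : Ω) : ℝ :=
  δ + dot (xi E D) (A t ω)

/-- The workload relaxation
`Ŵ(t+1) = Ŵ(t) - δ + Î(t) + Δ(t+1)` with `Ŵ(0) = w` and idleness process `Î`. -/
def workload {𝒟 𝒮 Ω : Type*} [Fintype 𝒟] [Fintype 𝒮] (E : Set (𝒟 × 𝒮)) (D : Set 𝒟) (δ : ℝ)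
    (A : ℕ → Ω → EuclideanSpace ℝ (𝒟 ⊕ 𝒮)) (w : ℝ) (I : ℕ → Ω → ℝ) : ℕ → Ω → ℝ
  | 0, _ => w
  | t + 1, ω => workload E D δ A w I t ω - δ + I t ω + disturbance E D δ A (t + 1) ω

/-- Admissible idleness processes: nonnegative and non-anticipative, that is, adapted to a
filtration to which the arrivals are adapted and of whose past the future arrivals are
independent (so that randomized policies are included). -/
def IsAdmissible {𝒟 𝒮 Ω : Type*} [Fintype 𝒟] [Fintype 𝒮] [mΩ : MeasurableSpace Ω]
    (P : Measure Ω) (A : ℕ → Ω → EuclideanSpace ℝ (𝒟 ⊕ 𝒮)) (I : ℕ → Ω → ℝ) : Prop :=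
  ∃ ℱ : Filtration ℕ mΩ,
    (∀ t, Measurable[ℱ t] (A t)) ∧
    (∀ t, Indep (ℱ t) (MeasurableSpace.comap (A (t + 1)) inferInstance) P) ∧
    (∀ t, Measurable[ℱ t] (I t)) ∧
    (∀ t ω, 0 ≤ I t ω)

/-- The long-run average of the expected (nonnegative) running cost `f` along the process `W`:
`limsup_N N⁻¹ ∑_{t<N} E[f(W(t))]`, as an extended nonnegative number. -/
def averageCost {Ω : Type*} [MeasurableSpace Ω] (P : Measure Ω) (f : ℝ → ℝ)
    (W : ℕ → Ω → ℝ) : ℝ≥0∞ :=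
  limsup (fun N : ℕ => (∑ t ∈ Finset.range N, ∫⁻ ω, ENNReal.ofReal (f (W t ω)) ∂P) / N) atTop

/-- The optimal average cost `η̂*` of the workload relaxation started at `w`. -/
def optimalWorkloadCost {𝒟 𝒮 Ω : Type*} [Fintype 𝒟] [Fintype 𝒮] [MeasurableSpace Ω]
    (P : Measure Ω) (E : Set (𝒟 × 𝒮)) (D : Set 𝒟) (c : 𝒟 ⊕ 𝒮 → ℝ) (δ : ℝ)
    (A : ℕ → Ω → EuclideanSpace ℝ (𝒟 ⊕ 𝒮)) (w : ℝ) : ℝ≥0∞ :=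
  ⨅ (I : ℕ → Ω → ℝ) (_ : IsAdmissible P A I),
    averageCost P (effectiveCost E D c) (workload E D δ A w I)

/-- The threshold of the diffusion heuristic,
`τ* = (1/2) (σ²_Δ / δ) log (1 + c̄₊ / c̄₋)`. -/
def tauStar {𝒟 𝒮 Ω : Type*} [Fintype 𝒟] [Fintype 𝒮] [MeasurableSpace Ω]
    (P : Measure Ω) (E : Set (𝒟 × 𝒮)) (D : Set 𝒟) (c : 𝒟 ⊕ 𝒮 → ℝ) (δ : ℝ)
    (A : ℕ → Ω → EuclideanSpace ℝ (𝒟 ⊕ 𝒮)) : ℝ :=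
  (1 / 2) * (variance (disturbance E D δ A 0) P / δ) * Real.log (1 + cPlus E D c / cMinus E D c)

/-- The diffusion approximation `η̂** = τ* c̄₋`. -/
def diffusionCost {𝒟 𝒮 Ω : Type*} [Fintype 𝒟] [Fintype 𝒮] [MeasurableSpace Ω]
    (P : Measure Ω) (E : Set (𝒟 × 𝒮)) (D : Set 𝒟) (c : 𝒟 ⊕ 𝒮 → ℝ) (δ : ℝ)
    (A : ℕ → Ω → EuclideanSpace ℝ (𝒟 ⊕ 𝒮)) : ℝ :=
  tauStar P E D c δ A * cMinus E D c

end BipartiteMatching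

end

noncomputable section

namespace BipartiteMatching

/-! The bound is a Poisson-inequality argument with a monotone test function. Write `a`, `b` for
`cPlus`, `cMinus`. Without idling, the floor of the workload is a walk on ℤ with up-probability `p`
and down-probability `p + δ`. Suppose `H` is bounded, nondecreasing, and has drift at least `b * T -
max (a * z) (-(b * z))` under this walk. Idling only raises the workload, hence only raises `H`, so
the drift bound survives every control. Telescoping then shows that each policy has average cost at
least `b * T`, less a further `b` for passing from the workload to its floor.

Such an `H` is built from its increments (`exists_potential`): they start at zero at level `-T`, are
driven by the recursion with ratio `r = (p + δ) / p`, and are truncated at zero. `H` is bounded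
because the increments vanish again far to the right, which is ensured by `b * r ^ T < a + b`, that
is, `T < log (1 + a / b) / log r`.

Since `log r` is close to `δ / p` and the variance is at most `2 * p + δ`, an integer `T` within a
bounded distance of `tauStar` is allowed (`exists_level`). Assumption (A3) bounds the
down-probability from below, which makes the error uniform in `δ`. -/

/-! ### Potential for the negatively biased walk on ℤ -/

/-- The increments of the potential: the least nonnegative solution of
`p * g (m + 1) - q * g m ≥ F (m + 1)` started from `0`. -/
def potentialStep (p q : ℝ) (F : ℕ → ℝ) : ℕ → ℝ
  | 0 => 0
  | m + 1 => max 0 ((q * potentialStep p q F m + F (m + 1)) / p)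

lemma potentialStep_nonneg (p q : ℝ) (F : ℕ → ℝ) (m : ℕ) : 0 ≤ potentialStep p q F m := by
  cases m with
  | zero => exact le_rfl
  | succ m => exact le_max_left _ _

lemma le_potentialStep {p q : ℝ} (hp : 0 < p) (F : ℕ → ℝ) (m : ℕ) :
    F (m + 1) ≤ p * potentialStep p q F (m + 1) - q * potentialStep p q F m := by
  have h : (q * potentialStep p q F m + F (m + 1)) / p ≤ potentialStep p q F (m + 1) :=
    le_max_right _ _
  rw [div_le_iff₀ hp] at h
  linarith

/-- Comparison principle: the right-hand side solves the untruncated recursion exactly with forcing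
`b * m`, and it is nonnegative, so it also dominates the truncation. -/
lemma potentialStep_le_of_le {p δ b : ℝ} (hp : 0 < p) (hδ : 0 < δ) (hb : 0 ≤ b)
    {F : ℕ → ℝ} (hF : ∀ m, F m ≤ b * m) (m : ℕ) :
    potentialStep p (p + δ) F m ≤
      b / δ ^ 2 * ((p + δ) * (((p + δ) / p) ^ m - 1) - δ * m) := by
  induction m with
  | zero => simp [potentialStep]
  | succ m ih =>
    refine max_le ?_ ?_
    -- Bernoulli's inequality makes the comparison solution nonnegative.
    · have h1 := one_add_mul_le_pow (a := δ / p) (by have := div_pos hδ hp; linarith) (m + 1)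
      have h2 : (p + δ) / p = 1 + δ / p := by field_simp
      rw [h2]
      have h3 : (((m + 1 : ℕ) : ℝ)) * (δ / p) ≤ (1 + δ / p) ^ (m + 1) - 1 := by linarith
      have h4 : (p + δ) * ((((m + 1 : ℕ) : ℝ)) * (δ / p)) ≥ δ * ((m + 1 : ℕ) : ℝ) := by
        have : (p + δ) * ((((m + 1 : ℕ) : ℝ)) * (δ / p))
            = δ * ((m + 1 : ℕ) : ℝ) + δ ^ 2 * ((m + 1 : ℕ) : ℝ) / p := by field_simp
        rw [this]
        have : 0 ≤ δ ^ 2 * ((m + 1 : ℕ) : ℝ) / p := by positivity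
        linarith
      have h5 := mul_le_mul_of_nonneg_left h3 (by linarith : 0 ≤ p + δ)
      apply mul_nonneg (by positivity)
      linarith
    · rw [div_le_iff₀ hp]
      have h1 := mul_le_mul_of_nonneg_left ih (by linarith : 0 ≤ p + δ)
      have h2 := hF (m + 1)
      have h3 : ((p + δ) / p) ^ (m + 1) * p = ((p + δ) / p) ^ m * (p + δ) := by
        rw [pow_succ]; field_simp
      have h4 : b / δ ^ 2 * ((p + δ) * (((p + δ) / p) ^ (m + 1) - 1) - δ * ((m + 1 : ℕ) : ℝ)) * p
          = b / δ ^ 2 * ((p + δ) * (((p + δ) / p) ^ (m + 1) * p - p)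
            - δ * ((m + 1 : ℕ) : ℝ) * p) := by ring
      rw [h4, h3]
      have h5 : b / δ ^ 2 * ((p + δ) * (((p + δ) / p) ^ m * (p + δ) - p)
            - δ * ((m + 1 : ℕ) : ℝ) * p)
          = (p + δ) * (b / δ ^ 2 * ((p + δ) * (((p + δ) / p) ^ m - 1) - δ * m))
            + b * ((m + 1 : ℕ) : ℝ) := by
        push_cast; field_simp; ring
      rw [h5]; linarith

/-- A zero past `T` forces the forcing to be nonpositive there; since it is nonincreasing from `T`
on, all later steps vanish. If no zero occurred, truncation would never act past `T`, and the linear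
recursion would contain a term `-ε * r ^ n` that drives it below zero. -/
lemma potentialStep_eventually_zero {p δ a b : ℝ} (hp : 0 < p) (hδ : 0 < δ) (ha : 0 ≤ a)
    (hb : 0 < b) {T : ℕ} (hT : b * ((p + δ) / p) ^ T < a + b)
    {F : ℕ → ℝ} (hF : ∀ m, F m ≤ b * m) (hF' : ∀ n, F (T + n) = b * T - a * n) :
    ∃ M, ∀ m, M ≤ m → potentialStep p (p + δ) F m = 0 := by
  set g := potentialStep p (p + δ) F with hg
  set r := (p + δ) / p with hr
  have hr1 : 1 < r := by rw [hr, lt_div_iff₀ hp]; linarith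
  by_cases h : ∃ n, g (T + n + 1) = 0
  · obtain ⟨n, hn⟩ := h
    refine ⟨T + n + 1, fun m hm => ?_⟩
    have hFn : F (T + n + 1) ≤ 0 := by
      have h1 := le_potentialStep (q := p + δ) hp F (T + n)
      rw [← hg, hn] at h1
      have := mul_nonneg (by linarith : 0 ≤ p + δ) (potentialStep_nonneg p (p + δ) F (T + n))
      rw [← hg] at this
      linarith
    induction m, hm using Nat.le_induction with
    | base => exact hn
    | succ m hm ih =>
      have h2 : F (m + 1) ≤ F (T + n + 1) := by
        obtain ⟨k, rfl⟩ := Nat.exists_eq_add_of_le hm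
        rw [show T + n + 1 + k + 1 = T + (n + 1 + k + 1) by ring, add_assoc T n 1, hF', hF']
        push_cast
        have := mul_nonneg ha (by positivity : (0 : ℝ) ≤ k + 1)
        linarith
      change max 0 (((p + δ) * g m + F (m + 1)) / p) = 0
      rw [ih, max_eq_left]
      exact div_nonpos_of_nonpos_of_nonneg (by linarith) hp.le
  · exfalso
    push Not at h
    -- The value of `ε` makes the bound below agree at `n = 0` with `potentialStep_le_of_le` at `T`.
    -- Its positivity is exactly `hT`.
    set ε := (p + δ) / δ ^ 2 * (a + b - b * r ^ T) with hε
    have hεpos : 0 < ε := mul_pos (by positivity) (by linarith)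
    -- The affine part is a particular solution for the forcing `b * T - a * n`; `r ^ n` solves the
    -- homogeneous recursion.
    have hbound : ∀ n : ℕ, g (T + n) ≤
        a / δ * n + (p + δ) * a / δ ^ 2 - b * T / δ - ε * r ^ n := by
      intro n
      induction n with
      | zero =>
        refine (potentialStep_le_of_le hp hδ hb.le hF T).trans (le_of_eq ?_)
        rw [← hr, hε]; push_cast; field_simp; ring
      | succ n ih =>
        have hne := h n
        have hval : g (T + n + 1) = ((p + δ) * g (T + n) + F (T + n + 1)) / p := by
          have h1 : g (T + n + 1) = max 0 (((p + δ) * g (T + n) + F (T + n + 1)) / p) := rfl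
          rcases max_choice 0 (((p + δ) * g (T + n) + F (T + n + 1)) / p) with h2 | h2
          · rw [h2] at h1; exact absurd h1 hne
          · rw [h2] at h1; exact h1
        rw [← add_assoc, hval, add_assoc T n 1, hF', div_le_iff₀ hp]
        have h1 := mul_le_mul_of_nonneg_left ih (by linarith : 0 ≤ p + δ)
        have h3 : r ^ (n + 1) * p = r ^ n * (p + δ) := by
          rw [pow_succ, hr]; field_simp
        have h4 : (a / δ * ((n + 1 : ℕ) : ℝ) + (p + δ) * a / δ ^ 2 - b * T / δ
            - ε * r ^ (n + 1)) * p = (a / δ * ((n + 1 : ℕ) : ℝ) + (p + δ) * a / δ ^ 2 - b * T / δ) * p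
            - ε * (r ^ (n + 1) * p) := by ring
        rw [h4, h3]
        have h5 : (a / δ * ((n + 1 : ℕ) : ℝ) + (p + δ) * a / δ ^ 2 - b * T / δ) * p
            - ε * (r ^ n * (p + δ)) = (p + δ) * (a / δ * n + (p + δ) * a / δ ^ 2 - b * T / δ
              - ε * r ^ n) + (b * T - a * ((n + 1 : ℕ) : ℝ)) := by
          push_cast; field_simp; ring
        rw [h5]; linarith
    have hlim : Tendsto (fun n : ℕ => (a / δ * n + ((p + δ) * a / δ ^ 2 - b * T / δ)) / r ^ n) atTop
        (nhds 0) := by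
      have h1 : Tendsto (fun n : ℕ => (n : ℝ) / r ^ n) atTop (nhds 0) := by
        simpa using tendsto_pow_const_div_const_pow_of_one_lt 1 hr1
      have h2 : Tendsto (fun n : ℕ => (1 : ℝ) / r ^ n) atTop (nhds 0) := by
        simpa using tendsto_pow_const_div_const_pow_of_one_lt 0 hr1
      have h3 := (h1.const_mul (a / δ)).add (h2.const_mul ((p + δ) * a / δ ^ 2 - b * T / δ))
      simp only [mul_zero, add_zero] at h3
      refine h3.congr fun n => ?_
      ring
    obtain ⟨n, hn⟩ := (hlim.eventually (gt_mem_nhds hεpos)).exists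
    have hrn : 0 < r ^ n := by positivity
    rw [div_lt_iff₀ hrn] at hn
    have := hbound n
    have h0 : 0 ≤ g (T + n) := potentialStep_nonneg _ _ _ _
    linarith

/-- A bounded nondecreasing potential for the simple random walk with up-probability `p` and
down-probability `q = p + δ`, whose drift certifies the average cost `b * T` for the cost function
`max (a * z) (-b * z)`. -/
lemma exists_potential {p δ a b : ℝ} (hp : 0 < p) (hδ : 0 < δ) (ha : 0 ≤ a)
    (hb : 0 < b) {T : ℕ} (hT : b * ((p + δ) / p) ^ T < a + b) :
    ∃ (H : ℤ → ℝ) (B : ℝ), Monotone H ∧ (∀ z, 0 ≤ H z) ∧ (∀ z, H z ≤ B) ∧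
      ∀ z : ℤ, b * T - max (a * z) (-(b * z)) ≤
        p * (H (z + 1) - H z) - (p + δ) * (H z - H (z - 1)) := by
  -- Index `m` stands for the level `z = m - T`, so the forcing vanishes at `m = 0`.
  set F : ℕ → ℝ := fun m => b * T - max (a * ((m : ℝ) - T)) (-(b * ((m : ℝ) - T))) with hFdef
  have hF : ∀ m, F m ≤ b * m := fun m => by
    have := le_max_right (a * ((m : ℝ) - T)) (-(b * ((m : ℝ) - T)))
    simp only [hFdef]; linarith
  have hF' : ∀ n, F (T + n) = b * T - a * n := fun n => by
    simp only [hFdef]; push_cast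
    rw [max_eq_left]
    · ring
    · have h1 : 0 ≤ b * (n : ℝ) := by positivity
      have h2 : 0 ≤ a * (n : ℝ) := by positivity
      simp only [add_sub_cancel_left]; linarith
  obtain ⟨M, hM⟩ := potentialStep_eventually_zero hp hδ ha hb hT hF hF'
  set g := potentialStep p (p + δ) F with hg
  have hg0 : ∀ m, 0 ≤ g m := potentialStep_nonneg _ _ _
  have hmono : Monotone fun n : ℕ => ∑ k ∈ Finset.range n, g k := fun m n hmn =>
    Finset.sum_le_sum_of_subset_of_nonneg (Finset.range_mono hmn) fun _ _ _ => hg0 _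
  refine ⟨fun z => ∑ k ∈ Finset.range (z + T).toNat, g k, ∑ k ∈ Finset.range M, g k,
    ?_, ?_, ?_, ?_⟩
  · intro y z hyz
    exact hmono (Int.toNat_le_toNat (by linarith))
  · exact fun z => Finset.sum_nonneg fun _ _ => hg0 _
  · intro z
    rcases le_total (z + T).toNat M with h | h
    · exact hmono h
    · refine le_of_eq ?_
      symm
      refine Finset.sum_subset (Finset.range_mono h) fun k _ hk => hM k ?_
      simpa using hk
  · intro z
    have hmax := le_max_right (a * (z : ℝ)) (-(b * z))
    -- At and below `-T` the potential is flat, thanks to `g 0 = 0`, and the cost there is already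
    -- at least `b * T`.
    by_cases hz : z + T ≤ 0
    · have h1 : (z + T).toNat = 0 := by omega
      have h2 : (z - 1 + T).toNat = 0 := by omega
      have h3 : (z + 1 + T).toNat ≤ 1 := by omega
      have h4 : ∑ k ∈ Finset.range (z + 1 + T).toNat, g k = 0 := by
        interval_cases (z + 1 + T).toNat
        · simp
        · simp [hg, potentialStep]
      simp only [h1, h2, h4]
      have h5 : (z : ℝ) + T ≤ 0 := by exact_mod_cast hz
      have h6 : b * (z + T) ≤ 0 := mul_nonpos_of_nonneg_of_nonpos hb.le h5
      simp
      rcases le_total (a * (z : ℝ)) (-(b * z)) with h | h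
      · right; linarith
      · left; linarith
    · obtain ⟨m, hm⟩ : ∃ m : ℕ, z + T = m + 1 := ⟨(z + T - 1).toNat, by omega⟩
      have h1 : (z + T).toNat = m + 1 := by omega
      have h2 : (z - 1 + T).toNat = m := by omega
      have h3 : (z + 1 + T).toNat = m + 1 + 1 := by omega
      simp only [h1, h2, h3, Finset.sum_range_succ]
      have h4 := le_potentialStep (q := p + δ) hp F m
      have h5 : (z : ℝ) = ((m + 1 : ℕ) : ℝ) - T := by
        have : ((z + T : ℤ) : ℝ) = ((m + 1 : ℤ) : ℝ) := by rw [hm]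
        push_cast at this ⊢; linarith
      simp only [hFdef] at h4
      rw [h5]
      rw [← hFdef, ← hg] at h4
      linarith

/-! ### Lower bounds for the effective cost -/

lemma sInf_image_nonneg {ι : Type*} {f : ι → ℝ} (hf : ∀ i, 0 < f i) (s : Set ι) :
    0 ≤ sInf (f '' s) :=
  Real.sInf_nonneg (by rintro _ ⟨i, _, rfl⟩; exact (hf i).le)

lemma sInf_image_pos {ι : Type*} [Finite ι] {f : ι → ℝ} (hf : ∀ i, 0 < f i) {s : Set ι}
    (hs : s.Nonempty) : 0 < sInf (f '' s) := by
  obtain ⟨i, _, hi⟩ := (hs.image f).csInf_mem ((Set.toFinite s).image f)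
  rw [← hi]
  exact hf i

lemma sInf_image_mul_sum_le {ι : Type*} [Fintype ι] {f x : ι → ℝ} (hf : ∀ i, 0 < f i)
    (hx : ∀ i, 0 ≤ x i) (s : Set ι) [DecidablePred (· ∈ s)] :
    sInf (f '' s) * ∑ i, (if i ∈ s then x i else 0) ≤ ∑ i, (if i ∈ s then f i * x i else 0) := by
  rw [Finset.mul_sum]
  refine Finset.sum_le_sum fun i _ => ?_
  split_ifs with h
  · refine mul_le_mul_of_nonneg_right (csInf_le ⟨0, ?_⟩ ⟨i, h, rfl⟩) (hx i)
    rintro _ ⟨j, _, rfl⟩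
    exact (hf j).le
  · simp

lemma sum_eq_sum_mem_add_sum_compl {ι : Type*} [Fintype ι] (f : ι → ℝ) (s : Set ι)
    [DecidablePred (· ∈ s)] :
    ∑ i, f i = ∑ i, (if i ∈ s then f i else 0) + ∑ i, (if i ∈ sᶜ then f i else 0) := by
  rw [← Finset.sum_add_distrib]
  refine Finset.sum_congr rfl fun i _ => ?_
  by_cases h : i ∈ s <;> simp [h]

/-- The demand term alone gives positivity; the supply term need only be nonnegative, which holds
even for an empty infimum. -/
lemma cMinus_pos {𝒟 𝒮 : Type*} [Finite 𝒟] [Finite 𝒮] {E : Set (𝒟 × 𝒮)} {D : Set 𝒟}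
    {c : 𝒟 ⊕ 𝒮 → ℝ} (hc : ∀ k, 0 < c k) (hD' : Dᶜ.Nonempty) : 0 < cMinus E D c :=
  add_pos_of_nonneg_of_pos (sInf_image_nonneg (fun _ => hc _) _)
    (sInf_image_pos (fun _ => hc _) hD')

lemma cPlus_nonneg {𝒟 𝒮 : Type*} {E : Set (𝒟 × 𝒮)} {D : Set 𝒟}
    {c : 𝒟 ⊕ 𝒮 → ℝ} (hc : ∀ k, 0 < c k) : 0 ≤ cPlus E D c :=
  add_nonneg (sInf_image_nonneg (fun _ => hc _) _) (sInf_image_nonneg (fun _ => hc _) _)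

/-- The effective cost dominates both of its linear pieces. -/
lemma max_le_effectiveCost {𝒟 𝒮 : Type*} [Fintype 𝒟] [Fintype 𝒮] {E : Set (𝒟 × 𝒮)} {D : Set 𝒟}
    {c : 𝒟 ⊕ 𝒮 → ℝ} (hc : ∀ k, 0 < c k) (hD : D.Nonempty) (hD' : Dᶜ.Nonempty)
    (hS : (supplyOf E D).Nonempty) (hS' : (supplyOf E D)ᶜ.Nonempty) (w : ℝ) :
    max (cPlus E D c * w) (-(cMinus E D c * w)) ≤ effectiveCost E D c w := by
  classical
  -- Feasibility must be shown, since the infimum of the empty set would be `0`. One demand and one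
  -- supply class, both holding `|w|`, suffice.
  have hfeas : ∃ x : 𝒟 ⊕ 𝒮 → ℝ, (∀ k, 0 ≤ x k) ∧ dot xi0 x = 0 ∧ dot (xi E D) x = w := by
    have key : ∀ (i : 𝒟) (j : 𝒮) (v : ℝ), 0 ≤ v →
        (∀ k, 0 ≤ Sum.elim (Pi.single i v) (Pi.single j v) k) ∧
        dot xi0 (Sum.elim (Pi.single i v) (Pi.single j v)) = 0 ∧
        dot (xi E D) (Sum.elim (Pi.single i v) (Pi.single j v)) =
          xi E D (Sum.inl i) * v + xi E D (Sum.inr j) * v := by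
      intro i j v hv
      refine ⟨?_, ?_, ?_⟩
      · rintro (k | k)
        · simp only [Sum.elim_inl, Pi.single_apply]; split_ifs <;> simp [hv]
        · simp only [Sum.elim_inr, Pi.single_apply]; split_ifs <;> simp [hv]
      · simp [dot, Fintype.sum_sum_type, xi0]
      · simp [dot, Fintype.sum_sum_type, Pi.single_apply]
    rcases le_total 0 w with hw | hw
    · obtain ⟨i, hi⟩ := hD
      obtain ⟨j, hj⟩ := hS'
      obtain ⟨h1, h2, h3⟩ := key i j w hw
      refine ⟨_, h1, h2, h3.trans ?_⟩
      have hj' : j ∉ supplyOf E D := hj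
      simp [xi, hi, hj']
    · obtain ⟨i, hi⟩ := hD'
      obtain ⟨j, hj⟩ := hS
      obtain ⟨h1, h2, h3⟩ := key i j (-w) (by linarith)
      refine ⟨_, h1, h2, h3.trans ?_⟩
      have hi' : i ∉ D := hi
      simp [xi, hi', hj]
  obtain ⟨x₀, h₀⟩ := hfeas
  refine le_csInf ⟨_, x₀, h₀.1, h₀.2.1, h₀.2.2, rfl⟩ ?_
  rintro _ ⟨x, hx, hx0, hxw, rfl⟩
  have e1 := sum_eq_sum_mem_add_sum_compl (fun i => x (Sum.inl i)) D
  have e2 := sum_eq_sum_mem_add_sum_compl (fun j => x (Sum.inr j)) (supplyOf E D)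
  have e3 := sum_eq_sum_mem_add_sum_compl (fun i => c (Sum.inl i) * x (Sum.inl i)) D
  have e4 := sum_eq_sum_mem_add_sum_compl (fun j => c (Sum.inr j) * x (Sum.inr j)) (supplyOf E D)
  have l1 := sInf_image_mul_sum_le (fun i => hc (Sum.inl i)) (fun i => hx (Sum.inl i)) D
  have l2 := sInf_image_mul_sum_le (fun i => hc (Sum.inl i)) (fun i => hx (Sum.inl i)) Dᶜ
  have l3 := sInf_image_mul_sum_le (fun j => hc (Sum.inr j)) (fun j => hx (Sum.inr j))
    (supplyOf E D)
  have l4 := sInf_image_mul_sum_le (fun j => hc (Sum.inr j)) (fun j => hx (Sum.inr j))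
    (supplyOf E D)ᶜ
  have n1 : 0 ≤ ∑ i, (if i ∈ D then x (Sum.inl i) else 0) :=
    Finset.sum_nonneg fun i _ => by split_ifs <;> simp [hx]
  have n2 : 0 ≤ ∑ i, (if i ∈ Dᶜ then x (Sum.inl i) else 0) :=
    Finset.sum_nonneg fun i _ => by split_ifs <;> simp [hx]
  have n3 : 0 ≤ ∑ j, (if j ∈ supplyOf E D then x (Sum.inr j) else 0) :=
    Finset.sum_nonneg fun i _ => by split_ifs <;> simp [hx]
  have n4 : 0 ≤ ∑ j, (if j ∈ (supplyOf E D)ᶜ then x (Sum.inr j) else 0) :=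
    Finset.sum_nonneg fun i _ => by split_ifs <;> simp [hx]
  have m1 := sInf_image_nonneg (fun i : 𝒟 => hc (Sum.inl i)) D
  have m2 := sInf_image_nonneg (fun i : 𝒟 => hc (Sum.inl i)) Dᶜ
  have m3 := sInf_image_nonneg (fun j : 𝒮 => hc (Sum.inr j)) (supplyOf E D)
  have m4 := sInf_image_nonneg (fun j : 𝒮 => hc (Sum.inr j)) (supplyOf E D)ᶜ
  simp only [dot, Fintype.sum_sum_type, xi0, xi, ite_mul, one_mul, zero_mul, neg_mul,
    Finset.sum_neg_distrib] at hx0 hxw ⊢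
  have hneg : ∑ j, (if j ∈ supplyOf E D then -x (Sum.inr j) else 0)
      = -∑ j, (if j ∈ supplyOf E D then x (Sum.inr j) else 0) := by
    rw [← Finset.sum_neg_distrib]
    exact Finset.sum_congr rfl fun j _ => by split_ifs <;> simp
  rw [hneg] at hxw
  rw [e1, e2] at hx0
  rw [e3, e4]
  unfold cPlus cMinus
  generalize ∑ i, (if i ∈ D then x (Sum.inl i) else 0) = a1 at *
  generalize ∑ i, (if i ∈ Dᶜ then x (Sum.inl i) else 0) = a2 at *
  generalize ∑ j, (if j ∈ supplyOf E D then x (Sum.inr j) else 0) = b1 at *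
  generalize ∑ j, (if j ∈ (supplyOf E D)ᶜ then x (Sum.inr j) else 0) = b2 at *
  -- Balance and workload together give `a1 - b1 = w = b2 - a2`: both masses priced by `cPlus` are
  -- at least `w`, both priced by `cMinus` at least `-w`.
  have ha1 : a1 = w + b1 := by linarith
  have hb2 : b2 = w + a2 := by linarith
  refine max_le ?_ ?_
  · subst ha1 hb2
    have := mul_nonneg m1 n3
    have := mul_nonneg m4 n2
    have := mul_nonneg m2 n2
    have := mul_nonneg m3 n3
    linarith
  · obtain rfl : w = a1 - b1 := by linarith
    obtain rfl : a2 = b1 + b2 - a1 := by linarith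
    have := mul_nonneg m1 n1
    have := mul_nonneg m2 n4
    have := mul_nonneg m3 n1
    have := mul_nonneg m4 n4
    linarith

/-! ### Law of a single workload increment -/

lemma measurable_dot {ι : Type*} [Fintype ι] (v : ι → ℝ) :
    Measurable fun x : EuclideanSpace ℝ ι => dot v x := by
  unfold dot
  fun_prop

lemma dot_integral {ι Ω : Type*} [Fintype ι] [MeasurableSpace Ω] {P : Measure Ω} (v : ι → ℝ)
    {X : Ω → EuclideanSpace ℝ ι} (hX : Integrable X P) :
    dot v (∫ ω, X ω ∂P : EuclideanSpace ℝ ι) = ∫ ω, dot v (X ω) ∂P := by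
  have h (x : EuclideanSpace ℝ ι) :
      dot v x = (∑ k, v k • EuclideanSpace.proj (𝕜 := ℝ) k : EuclideanSpace ℝ ι →L[ℝ] ℝ) x := by
    simp [dot]
  simp only [h]
  exact (ContinuousLinearMap.integral_comp_comm
    (∑ k, v k • EuclideanSpace.proj (𝕜 := ℝ) k : EuclideanSpace ℝ ι →L[ℝ] ℝ) hX).symm

/-- One demand contributes `0` or `1`, one supply `0` or `-1`. Integer increments are what let the
floor of the workload move as a nearest-neighbour walk. -/
lemma dot_xi_mem_of_mem_arrivalSet {𝒟 𝒮 : Type*} [Fintype 𝒟] [Fintype 𝒮] {E 𝒜 : Set (𝒟 × 𝒮)}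
    {D : Set 𝒟} {a : EuclideanSpace ℝ (𝒟 ⊕ 𝒮)} (ha : a ∈ arrivalSet 𝒜) :
    dot (xi E D) a = 1 ∨ dot (xi E D) a = 0 ∨ dot (xi E D) a = -1 := by
  classical
  obtain ⟨i, j, -, rfl⟩ := ha
  have h : dot (xi E D) (EuclideanSpace.single (Sum.inl i) (1 : ℝ) +
      EuclideanSpace.single (Sum.inr j) (1 : ℝ) : EuclideanSpace ℝ (𝒟 ⊕ 𝒮)) =
      xi E D (Sum.inl i) + xi E D (Sum.inr j) := by
    simp [dot, mul_add, Finset.sum_add_distrib]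
  rw [h]
  by_cases h1 : i ∈ D <;> by_cases h2 : j ∈ supplyOf E D <;> simp [xi, h1, h2]

lemma norm_le_of_mem_arrivalSet {𝒟 𝒮 : Type*} [Fintype 𝒟] [Fintype 𝒮] {𝒜 : Set (𝒟 × 𝒮)}
    {a : EuclideanSpace ℝ (𝒟 ⊕ 𝒮)} (ha : a ∈ arrivalSet 𝒜) : ‖a‖ ≤ 2 := by
  classical
  obtain ⟨i, j, -, rfl⟩ := ha
  refine (norm_add_le _ _).trans ?_
  simp
  norm_num

/-- An arriving pair with supply in `𝒮(D)` and demand outside `D` decreases the workload. -/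
lemma dot_xi_eq_neg_one {𝒟 𝒮 : Type*} [Fintype 𝒟] [Fintype 𝒮] {E 𝒜 : Set (𝒟 × 𝒮)}
    {D : Set 𝒟} {a : EuclideanSpace ℝ (𝒟 ⊕ 𝒮)} (ha : a ∈ arrivalSet 𝒜) {i₀ : 𝒮}
    (hi₀ : i₀ ∈ supplyOf E D) {j₀ : 𝒟} (hj₀ : j₀ ∈ Dᶜ) (h1 : 1 ≤ a (Sum.inr i₀))
    (h2 : 1 ≤ a (Sum.inl j₀)) : dot (xi E D) a = -1 := by
  classical
  obtain ⟨i, j, -, rfl⟩ := ha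
  have h : dot (xi E D) (EuclideanSpace.single (Sum.inl i) (1 : ℝ) +
      EuclideanSpace.single (Sum.inr j) (1 : ℝ) : EuclideanSpace ℝ (𝒟 ⊕ 𝒮)) =
      xi E D (Sum.inl i) + xi E D (Sum.inr j) := by
    simp [dot, mul_add, Finset.sum_add_distrib]
  have hi : j₀ = i := by
    by_contra hne
    simp [hne] at h2
    linarith
  have hj : i₀ = j := by
    by_contra hne
    simp [hne] at h1
    linarith
  subst hi hj
  have hj₀' : j₀ ∉ D := hj₀
  rw [h]
  simp [xi, hi₀, hj₀']

/-- A `{-1, 0, 1}`-valued variable is the difference of the indicators of `{1}` and `{-1}`. -/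
lemma integral_eq_measureReal_sub {Ω : Type*} [MeasurableSpace Ω] {P : Measure Ω}
    [IsProbabilityMeasure P] {X : Ω → ℝ} (hX : Measurable X)
    (hX' : ∀ᵐ ω ∂P, X ω = 1 ∨ X ω = 0 ∨ X ω = -1) :
    ∫ ω, X ω ∂P = P.real (X ⁻¹' {1}) - P.real (X ⁻¹' {-1}) := by
  have m1 : MeasurableSet (X ⁻¹' {1}) := hX (measurableSet_singleton _)
  have m2 : MeasurableSet (X ⁻¹' {-1}) := hX (measurableSet_singleton _)
  have i : ∀ x : ℝ, MeasurableSet (X ⁻¹' {x}) → Integrable ((X ⁻¹' {x}).indicator 1) P :=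
    fun x hx => (integrable_const (1 : ℝ)).indicator hx
  rw [← integral_indicator_one m1, ← integral_indicator_one m2, ← integral_sub
    (i 1 m1) (i (-1) m2)]
  refine integral_congr_ae (hX'.mono fun ω h => ?_)
  rcases h with h | h | h <;> simp [Set.indicator, h] <;> norm_num

lemma integral_sq_eq_measureReal_add {Ω : Type*} [MeasurableSpace Ω] {P : Measure Ω}
    [IsProbabilityMeasure P] {X : Ω → ℝ} (hX : Measurable X)
    (hX' : ∀ᵐ ω ∂P, X ω = 1 ∨ X ω = 0 ∨ X ω = -1) :
    ∫ ω, X ω ^ 2 ∂P = P.real (X ⁻¹' {1}) + P.real (X ⁻¹' {-1}) := by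
  have m1 : MeasurableSet (X ⁻¹' {1}) := hX (measurableSet_singleton _)
  have m2 : MeasurableSet (X ⁻¹' {-1}) := hX (measurableSet_singleton _)
  have i : ∀ x : ℝ, MeasurableSet (X ⁻¹' {x}) → Integrable ((X ⁻¹' {x}).indicator 1) P :=
    fun x hx => (integrable_const (1 : ℝ)).indicator hx
  rw [← integral_indicator_one m1, ← integral_indicator_one m2, ← integral_add
    (i 1 m1) (i (-1) m2)]
  refine integral_congr_ae (hX'.mono fun ω h => ?_)
  rcases h with h | h | h <;> simp [Set.indicator, h] <;> norm_num

lemma measureReal_add_le_one {Ω : Type*} [MeasurableSpace Ω] {P : Measure Ω}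
    [IsProbabilityMeasure P] {X : Ω → ℝ} (hX : Measurable X) :
    P.real (X ⁻¹' {1}) + P.real (X ⁻¹' {-1}) ≤ 1 := by
  have hd : Disjoint (X ⁻¹' {1}) (X ⁻¹' {-1}) := by
    rw [Set.disjoint_left]
    intro ω h1 h2
    simp only [Set.mem_preimage, Set.mem_singleton_iff] at h1 h2
    norm_num [h1] at h2
  rw [← measureReal_union hd (hX (measurableSet_singleton _))]
  exact measureReal_le_one

/-! ### Drift and telescoping -/

/-- One-step drift inequality for a nondecreasing potential of the integer part of the workload. -/
lemma drift_le_integral {Ω : Type*} {m mΩ : MeasurableSpace Ω} {P : Measure Ω}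
    [IsProbabilityMeasure P] (hm : m ≤ mΩ) {W W' X : Ω → ℝ} (hW : Measurable[m] W)
    (hW' : Measurable W') (hX : Measurable X)
    (hind : Indep m (MeasurableSpace.comap X inferInstance) P)
    (hX' : ∀ᵐ ω ∂P, X ω = 1 ∨ X ω = 0 ∨ X ω = -1) (hWW' : ∀ ω, W ω + X ω ≤ W' ω)
    {H : ℤ → ℝ} {B : ℝ} (hH : Monotone H) (hH0 : ∀ z, 0 ≤ H z) (hHB : ∀ z, H z ≤ B) :
    ∫ ω, (P.real (X ⁻¹' {1}) * (H (⌊W ω⌋ + 1) - H ⌊W ω⌋)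
        - P.real (X ⁻¹' {-1}) * (H ⌊W ω⌋ - H (⌊W ω⌋ - 1))) ∂P
      ≤ ∫ ω, H ⌊W' ω⌋ ∂P - ∫ ω, H ⌊W ω⌋ ∂P := by
  have m1 : MeasurableSet (X ⁻¹' {1}) := hX (measurableSet_singleton _)
  have m2 : MeasurableSet (X ⁻¹' {-1}) := hX (measurableSet_singleton _)
  have hind' : ∀ (G : ℤ → ℝ) (s : Set ℝ), MeasurableSet s →
      ∫ ω, (X ⁻¹' s).indicator (fun _ => (1 : ℝ)) ω * G ⌊W ω⌋ ∂P =
        P.real (X ⁻¹' s) * ∫ ω, G ⌊W ω⌋ ∂P := by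
    intro G s hs
    have hG : Measurable[m] fun ω => G ⌊W ω⌋ :=
      (measurable_of_countable G).comp (Int.measurable_floor.comp hW)
    have hs' : Measurable[MeasurableSpace.comap X inferInstance]
        ((X ⁻¹' s).indicator fun _ => (1 : ℝ)) :=
      measurable_const.indicator ⟨s, hs, rfl⟩
    have hi : IndepFun ((X ⁻¹' s).indicator fun _ => (1 : ℝ)) (fun ω => G ⌊W ω⌋) P := by
      rw [IndepFun_iff_Indep]
      exact indep_of_indep_of_le_left (indep_of_indep_of_le_right hind.symm hG.comap_le)
        hs'.comap_le
    rw [hi.integral_fun_mul_eq_mul_integral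
      (hs'.mono hX.comap_le le_rfl).aestronglyMeasurable (hG.mono hm le_rfl).aestronglyMeasurable]
    congr 1
    exact integral_indicator_one (hX hs)
  have hWm : Measurable W := hW.mono hm le_rfl
  have hbdd : ∀ (G : ℤ → ℝ) (V : Ω → ℝ), Measurable V → (∀ z, ‖G z‖ ≤ B) →
      Integrable (fun ω => G ⌊V ω⌋) P := fun G V hV hG =>
    Integrable.of_bound ((measurable_of_countable G).comp
      (Int.measurable_floor.comp hV)).aestronglyMeasurable B (ae_of_all _ fun ω => hG _)
  have hHn : ∀ z, ‖H z‖ ≤ B := fun z => by rw [Real.norm_of_nonneg (hH0 z)]; exact hHB z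
  have iW := hbdd H W hWm hHn
  have iW' := hbdd H W' hW' hHn
  have iu := hbdd (fun z => H (z + 1) - H z) W hWm fun z => by
    rw [Real.norm_of_nonneg (sub_nonneg.2 (hH (by linarith)))]
    linarith [hHB (z + 1), hH0 z]
  have id := hbdd (fun z => H z - H (z - 1)) W hWm fun z => by
    rw [Real.norm_of_nonneg (sub_nonneg.2 (hH (by linarith)))]
    linarith [hHB z, hH0 (z - 1)]
  have hmul : ∀ (s : Set Ω) (f : Ω → ℝ), MeasurableSet s → Integrable f P →
      Integrable (fun ω => s.indicator (fun _ => (1 : ℝ)) ω * f ω) P := fun s f hs hf => by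
    refine (hf.indicator hs).congr (ae_of_all _ fun ω => ?_)
    by_cases h : ω ∈ s <;> simp [h]
  have ju := hmul _ _ m1 iu
  have jd := hmul _ _ m2 id
  rw [integral_sub (iu.const_mul _) (id.const_mul _), integral_const_mul, integral_const_mul,
    ← hind' (fun z => H (z + 1) - H z) _ (measurableSet_singleton _),
    ← hind' (fun z => H z - H (z - 1)) _ (measurableSet_singleton _),
    ← integral_sub ju jd, ← integral_sub iW' iW]
  refine integral_mono_ae (ju.sub jd) (iW'.sub iW) (hX'.mono fun ω h => ?_)
  -- Monotonicity of `H` disposes of the control here.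
  have hle : H ⌊W ω + X ω⌋ ≤ H ⌊W' ω⌋ := hH (Int.floor_le_floor (hWW' ω))
  rcases h with h | h | h <;> rw [h] at hle <;> simp [Set.indicator, h]
  · rw [Int.floor_add_one] at hle
    norm_num
    linarith
  · simpa using hle
  · rw [← sub_eq_add_neg, Int.floor_sub_one] at hle
    norm_num
    linarith

lemma ofReal_integral_le_lintegral {Ω : Type*} [MeasurableSpace Ω] {P : Measure Ω} {f : Ω → ℝ}
    (hf : Integrable f P) : ENNReal.ofReal (∫ ω, f ω ∂P) ≤ ∫⁻ ω, ENNReal.ofReal (f ω) ∂P := by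
  refine (ENNReal.ofReal_le_ofReal (integral_mono hf hf.pos_part fun ω => le_max_left _ 0)).trans ?_
  rw [ofReal_integral_eq_lintegral_ofReal hf.pos_part (ae_of_all _ fun ω => le_max_right _ _)]
  simp

/-- A bounded potential with drift at least `κ` minus the running cost bounds the average cost. -/
lemma ofReal_le_averageCost {Ω : Type*} [MeasurableSpace Ω] {P : Measure Ω} {f : ℝ → ℝ}
    {W : ℕ → Ω → ℝ} {κ B : ℝ} {a : ℕ → ℝ} (ha0 : ∀ t, 0 ≤ a t) (haB : ∀ t, a t ≤ B)
    (h : ∀ t, ENNReal.ofReal (κ - (a (t + 1) - a t)) ≤ ∫⁻ ω, ENNReal.ofReal (f (W t ω)) ∂P) :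
    ENNReal.ofReal κ ≤ averageCost P f W := by
  have hsum : ∀ N : ℕ, ENNReal.ofReal (N * κ - (a N - a 0)) ≤
      ∑ t ∈ Finset.range N, ∫⁻ ω, ENNReal.ofReal (f (W t ω)) ∂P := by
    intro N
    induction N with
    | zero => simp
    | succ N ih =>
      rw [Finset.sum_range_succ]
      refine le_trans ?_ (add_le_add ih (h N))
      -- Telescoping by subadditivity of `ofReal` stays valid when expected costs are infinite or
      -- individual drift bounds negative.
      refine le_trans (le_of_eq ?_) ENNReal.ofReal_add_le
      congr 1
      push_cast
      ring
  have hlim : Tendsto (fun N : ℕ => ENNReal.ofReal (κ - B / N)) atTop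
      (nhds (ENNReal.ofReal κ)) := by
    refine ENNReal.tendsto_ofReal ?_
    simpa using (tendsto_const_nhds (x := κ)).sub (tendsto_const_div_atTop_nhds_zero_nat B)
  rw [← hlim.limsup_eq]
  refine limsup_le_limsup ?_
  filter_upwards [eventually_gt_atTop 0] with N hN
  have hN' : (0 : ℝ) < N := by exact_mod_cast hN
  rw [ENNReal.le_div_iff_mul_le (by simp [hN.ne']) (by simp), ← ENNReal.ofReal_natCast N,
    ← ENNReal.ofReal_mul' hN'.le]
  refine le_trans (ENNReal.ofReal_le_ofReal ?_) (hsum N)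
  have : (κ - B / N) * N = N * κ - B := by field_simp
  rw [this]
  linarith [ha0 0, haB N]

/-! ### Choice of the level -/

/-- The diffusion threshold is either bounded, or exceeds by a bounded amount an integer level at
which the random walk with up-probability `p` and down-probability `p + δ` has a potential. -/
lemma exists_level {p δ ρ v a b : ℝ} (hδ : 0 < δ) (hρ : 0 < ρ) (hρp : ρ ≤ p + δ)
    (hp1 : p + (p + δ) ≤ 1) (hv0 : 0 ≤ v) (hv : v ≤ p + (p + δ)) (ha : 0 ≤ a) (hb : 0 < b) :
    1 / 2 * (v / δ) * Real.log (1 + a / b) ≤ Real.log (1 + a / b) / ρ + 2 ∨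
      0 < p ∧ ∃ T : ℕ, b * ((p + δ) / p) ^ T < a + b ∧
        1 / 2 * (v / δ) * Real.log (1 + a / b) ≤ T + 1 + (Real.log (1 + a / b) / ρ + 2) := by
  have hab : 0 ≤ a / b := by positivity
  set L := Real.log (1 + a / b) with hL
  have hL0 : 0 ≤ L := Real.log_nonneg (by linarith)
  set τ := 1 / 2 * (v / δ) * L with hτ
  -- For small `δ` the up-probability is at least `ρ / 2`; otherwise `v ≤ 1` already gives `τ ≤ L /
  -- ρ`.
  by_cases hδρ : δ < ρ / 2
  · have hp0 : ρ / 2 ≤ p := by linarith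
    have hppos : 0 < p := by linarith
    rcases le_total τ (L / ρ + 2) with h | h
    · exact Or.inl h
    refine Or.inr ⟨hppos, ⌊τ - (L / ρ + 2)⌋₊, ?_, ?_⟩
    · set T := ⌊τ - (L / ρ + 2)⌋₊
      have hT : (T : ℝ) ≤ τ - (L / ρ + 2) := Nat.floor_le (by linarith)
      set r := (p + δ) / p with hr
      have hrpos : 0 < r := by positivity
      have hlog1 : Real.log r ≤ δ / p := by
        refine (Real.log_le_sub_one_of_pos hrpos).trans (le_of_eq ?_)
        rw [hr]; field_simp; ring
      have hlog2 : δ ≤ Real.log r := by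
        have h1 := Real.one_sub_inv_le_log_of_pos hrpos
        have h2 : 1 - r⁻¹ = δ / (p + δ) := by rw [hr]; field_simp; ring
        have h3 : δ ≤ δ / (p + δ) := by
          rw [le_div_iff₀ (by linarith)]
          exact mul_le_of_le_one_right hδ.le (by linarith)
        linarith
      have h1 : T * Real.log r ≤ (τ - (L / ρ + 2)) * Real.log r :=
        mul_le_mul_of_nonneg_right hT (by linarith)
      have hτ0 : 0 ≤ τ := by positivity
      have h2 : τ * Real.log r ≤ τ * (δ / p) := mul_le_mul_of_nonneg_left hlog1 hτ0
      have h3 : (L / ρ + 2) * δ ≤ (L / ρ + 2) * Real.log r :=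
        mul_le_mul_of_nonneg_left hlog2 (by positivity)
      have h4 : τ * (δ / p) = v / (2 * p) * L := by rw [hτ]; field_simp
      have h5 : v / (2 * p) ≤ 1 + δ / ρ := by
        have h6 : v / (2 * p) ≤ (p + (p + δ)) / (2 * p) := by gcongr
        have h7 : (p + (p + δ)) / (2 * p) = 1 + δ / (2 * p) := by field_simp; ring
        have h8 : δ / (2 * p) ≤ δ / ρ := by gcongr; linarith
        linarith
      have h6 := mul_le_mul_of_nonneg_right h5 hL0
      have h7 : (1 + δ / ρ) * L = L + L / ρ * δ := by ring
      -- The shift `L / ρ` absorbs the error `L / ρ * δ` in `τ * log r`; the extra `2` leaves `L - 2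
      -- * δ`, whence strictness.
      have h8 : Real.log (r ^ T) < Real.log (1 + a / b) := by
        rw [Real.log_pow, ← hL]; nlinarith
      have h9 : r ^ T < 1 + a / b := (Real.log_lt_log_iff (by positivity) (by positivity)).1 h8
      calc b * r ^ T < b * (1 + a / b) := mul_lt_mul_of_pos_left h9 hb
        _ = a + b := by field_simp; ring
    · have := Nat.lt_floor_add_one (τ - (L / ρ + 2))
      linarith
  · left
    have h1 : v / δ ≤ 1 / (ρ / 2) := div_le_div₀ zero_le_one (by linarith) (by positivity)
      (by linarith)
    have h2 : τ ≤ 1 / 2 * (1 / (ρ / 2)) * L := by rw [hτ]; gcongr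
    have h3 : 1 / 2 * (1 / (ρ / 2)) * L = L / ρ := by field_simp
    linarith

/-! ### The controlled workload and its jump probabilities -/

variable {𝒟 𝒮 Ω : Type*} [Fintype 𝒟] [Fintype 𝒮] [mΩ : MeasurableSpace Ω]

/-- A level `T` at which the uncontrolled random walk has a potential bounds the optimal cost of
the workload relaxation from below. -/
lemma le_optimalWorkloadCost {P : Measure Ω} [IsProbabilityMeasure P]
    {E 𝒜 : Set (𝒟 × 𝒮)} {c : 𝒟 ⊕ 𝒮 → ℝ} (hc : ∀ k, 0 < c k) {D : Set 𝒟} (hD : D.Nonempty)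
    (hD' : Dᶜ.Nonempty) (hS : (supplyOf E D).Nonempty) (hS' : (supplyOf E D)ᶜ.Nonempty)
    {A : ℕ → Ω → EuclideanSpace ℝ (𝒟 ⊕ 𝒮)} (hA : IsArrivalProcess P 𝒜 A) {p δ : ℝ}
    (hp : 0 < p) (hδ : 0 < δ)
    (hpA : P.real ((fun ω => dot (xi E D) (A 0 ω)) ⁻¹' {1}) = p)
    (hqA : P.real ((fun ω => dot (xi E D) (A 0 ω)) ⁻¹' {-1}) = p + δ) {T : ℕ}
    (hT : cMinus E D c * ((p + δ) / p) ^ T < cPlus E D c + cMinus E D c) (w : ℝ) :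
    ENNReal.ofReal (cMinus E D c * T - cMinus E D c) ≤
      optimalWorkloadCost P E D c δ A w := by
  have hb := cMinus_pos (E := E) hc hD'
  have ha := cPlus_nonneg (E := E) (D := D) hc
  obtain ⟨H, B, hH, hH0, hHB, hdrift⟩ := exists_potential hp hδ ha hb hT
  refine le_iInf₂ fun I hI => ?_
  obtain ⟨ℱ, hAℱ, hind, hIℱ, hI0⟩ := hI
  set W := workload E D δ A w I with hWdef
  have hstep : ∀ t ω, W (t + 1) ω = W t ω + I t ω + dot (xi E D) (A (t + 1) ω) := fun t ω => by
    simp only [hWdef, workload, disturbance]; ring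
  have hWℱ : ∀ t, Measurable[ℱ t] (W t) := by
    intro t
    induction t with
    | zero => exact measurable_const
    | succ t ih =>
      have h1 : Measurable[ℱ (t + 1)] (W t) := ih.mono (ℱ.mono t.le_succ) le_rfl
      have h2 : Measurable[ℱ (t + 1)] (I t) := (hIℱ t).mono (ℱ.mono t.le_succ) le_rfl
      have h3 : Measurable[ℱ (t + 1)] fun ω => dot (xi E D) (A (t + 1) ω) :=
        (measurable_dot _).comp (hAℱ (t + 1))
      have h4 : W (t + 1) = fun ω => W t ω + I t ω + dot (xi E D) (A (t + 1) ω) :=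
        funext (hstep t)
      rw [h4]
      exact (h1.add h2).add h3
  have hWm : ∀ t, Measurable (W t) := fun t => (hWℱ t).mono (ℱ.le t) le_rfl
  have hfl : ∀ t, ∫ ω, H ⌊W t ω⌋ ∂P ≤ B := fun t => by
    have := integral_mono_of_nonneg (μ := P) (ae_of_all _ fun ω => hH0 ⌊W t ω⌋)
      (integrable_const B) (ae_of_all _ fun ω => hHB ⌊W t ω⌋)
    simpa using this
  refine ofReal_le_averageCost (a := fun t => ∫ ω, H ⌊W t ω⌋ ∂P) (B := B)
    (fun t => integral_nonneg fun ω => hH0 _) hfl fun t => ?_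
  set X : Ω → ℝ := fun ω => dot (xi E D) (A (t + 1) ω) with hX
  have hXm : Measurable X := (measurable_dot _).comp (hA.measurable _)
  have hlaw : ∀ x : ℝ, P.real (X ⁻¹' {x}) =
      P.real ((fun ω => dot (xi E D) (A 0 ω)) ⁻¹' {x}) := fun x => by
    have h := ((hA.identDistrib (t + 1)).comp (measurable_dot (xi E D))).measure_mem_eq
      (measurableSet_singleton x)
    exact congrArg ENNReal.toReal h
  have hXind : Indep (ℱ t) (MeasurableSpace.comap X inferInstance) P := by
    refine indep_of_indep_of_le_right (hind t) ?_
    have h1 : X = (fun x : EuclideanSpace ℝ (𝒟 ⊕ 𝒮) => dot (xi E D) x) ∘ A (t + 1) := rfl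
    rw [h1, ← MeasurableSpace.comap_comp]
    exact MeasurableSpace.comap_mono (measurable_dot _).comap_le
  have hd := drift_le_integral (ℱ.le t) (hWℱ t) (hWm (t + 1)) hXm hXind
    ((hA.mem_arrivalSet (t + 1)).mono fun ω h => dot_xi_mem_of_mem_arrivalSet h)
    (fun ω => by rw [hstep]; linarith [hI0 t ω]) hH hH0 hHB
  rw [hlaw, hlaw, hpA, hqA] at hd
  set b := cMinus E D c
  set κ := b * T - b
  have hbddH : ∀ z, |p * (H (z + 1) - H z) - (p + δ) * (H z - H (z - 1))| ≤ (p + (p + δ)) * B := by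
    intro z
    have h1 := hH (show z ≤ z + 1 by linarith)
    have h2 := hH (show z - 1 ≤ z by linarith)
    have h3 := mul_le_mul_of_nonneg_left
      (show H (z + 1) - H z ≤ B by linarith [hHB (z + 1), hH0 z]) hp.le
    have h4 := mul_le_mul_of_nonneg_left
      (show H z - H (z - 1) ≤ B by linarith [hHB z, hH0 (z - 1)]) (by linarith : 0 ≤ p + δ)
    have h5 := mul_nonneg hp.le (sub_nonneg.2 h1)
    have h6 := mul_nonneg (by linarith : 0 ≤ p + δ) (sub_nonneg.2 h2)
    rw [abs_le]
    constructor <;> linarith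
  have hint : Integrable (fun ω => p * (H (⌊W t ω⌋ + 1) - H ⌊W t ω⌋)
      - (p + δ) * (H ⌊W t ω⌋ - H (⌊W t ω⌋ - 1))) P :=
    Integrable.of_bound ((measurable_of_countable
      fun z : ℤ => p * (H (z + 1) - H z) - (p + δ) * (H z - H (z - 1))).comp
        (Int.measurable_floor.comp (hWm t))).aestronglyMeasurable ((p + (p + δ)) * B)
      (ae_of_all _ fun ω => hbddH _)
  have hcost : ∀ ω, κ - (p * (H (⌊W t ω⌋ + 1) - H ⌊W t ω⌋)
      - (p + δ) * (H ⌊W t ω⌋ - H (⌊W t ω⌋ - 1))) ≤ effectiveCost E D c (W t ω) := by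
    intro ω
    have h1 := max_le_effectiveCost hc hD hD' hS hS' (W t ω)
    have h2 := hdrift ⌊W t ω⌋
    -- Rounding down lowers the `cPlus` piece and raises the `cMinus` piece by at most `b`; this is
    -- the `b` subtracted in `κ`.
    have h3 := mul_le_mul_of_nonneg_left (Int.floor_le (W t ω)) ha
    have h4 := mul_le_mul_of_nonneg_left (Int.lt_floor_add_one (W t ω)).le hb.le
    have h5 := (le_max_left _ _).trans h1
    have h6 := (le_max_right _ _).trans h1
    have h7 : max (cPlus E D c * (⌊W t ω⌋ : ℝ)) (-(b * ⌊W t ω⌋)) ≤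
        effectiveCost E D c (W t ω) + b := max_le (by linarith) (by linarith)
    linarith
  calc ENNReal.ofReal (κ - (∫ ω, H ⌊W (t + 1) ω⌋ ∂P - ∫ ω, H ⌊W t ω⌋ ∂P))
      ≤ ENNReal.ofReal (∫ ω, (κ - (p * (H (⌊W t ω⌋ + 1) - H ⌊W t ω⌋)
          - (p + δ) * (H ⌊W t ω⌋ - H (⌊W t ω⌋ - 1)))) ∂P) := by
        refine ENNReal.ofReal_le_ofReal ?_
        rw [integral_sub (integrable_const κ) hint]
        simp only [integral_const, probReal_univ, one_smul]
        linarith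
    _ ≤ ∫⁻ ω, ENNReal.ofReal (κ - (p * (H (⌊W t ω⌋ + 1) - H ⌊W t ω⌋)
          - (p + δ) * (H ⌊W t ω⌋ - H (⌊W t ω⌋ - 1)))) ∂P :=
        ofReal_integral_le_lintegral ((integrable_const κ).sub hint)
    _ ≤ _ := lintegral_mono fun ω => ENNReal.ofReal_le_ofReal (hcost ω)

/-- The jump probabilities of the workload differ by the negative drift, the probability of a
downward jump is at least that of `i₀`-supply with `j₀`-demand, and their sum bounds the variance
of the disturbance. -/
lemma jump_probabilities {P : Measure Ω} [IsProbabilityMeasure P]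
    {E 𝒜 : Set (𝒟 × 𝒮)} {D : Set 𝒟} {A : ℕ → Ω → EuclideanSpace ℝ (𝒟 ⊕ 𝒮)}
    (hA : IsArrivalProcess P 𝒜 A) {δ ρ : ℝ} (hmean : dot (xi E D) (meanArrival P A) = -δ)
    {i₀ : 𝒮} (hi₀ : i₀ ∈ supplyOf E D) {j₀ : 𝒟} (hj₀ : j₀ ∈ Dᶜ)
    (hρ : ρ ≤ P.real {ω | 1 ≤ A 0 ω (Sum.inr i₀) ∧ 1 ≤ A 0 ω (Sum.inl j₀)}) :
    let X : Ω → ℝ := fun ω => dot (xi E D) (A 0 ω)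
    P.real (X ⁻¹' {-1}) = P.real (X ⁻¹' {1}) + δ ∧ ρ ≤ P.real (X ⁻¹' {-1}) ∧
      P.real (X ⁻¹' {1}) + P.real (X ⁻¹' {-1}) ≤ 1 ∧
      variance (disturbance E D δ A 0) P ≤ P.real (X ⁻¹' {1}) + P.real (X ⁻¹' {-1}) := by
  intro X
  have hXm : Measurable X := (measurable_dot _).comp (hA.measurable _)
  have hX' : ∀ᵐ ω ∂P, X ω = 1 ∨ X ω = 0 ∨ X ω = -1 :=
    (hA.mem_arrivalSet 0).mono fun ω h => dot_xi_mem_of_mem_arrivalSet h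
  have hint : Integrable (A 0) P :=
    Integrable.of_bound (hA.measurable 0).aestronglyMeasurable 2
      ((hA.mem_arrivalSet 0).mono fun ω h => norm_le_of_mem_arrivalSet h)
  refine ⟨?_, hρ.trans ?_, measureReal_add_le_one hXm, ?_⟩
  · have h1 := integral_eq_measureReal_sub hXm hX'
    rw [meanArrival, dot_integral _ hint] at hmean
    change ∫ ω, X ω ∂P = -δ at hmean
    linarith
  · refine ENNReal.toReal_mono (measure_ne_top _ _) (measure_mono_ae ?_)
    exact (hA.mem_arrivalSet 0).mono fun ω h hω => dot_xi_eq_neg_one h hi₀ hj₀ hω.1 hω.2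
  · have h1 : variance (disturbance E D δ A 0) P = variance X P :=
      variance_const_add hXm.aestronglyMeasurable δ
    rw [h1, ← integral_sq_eq_measureReal_add hXm hX']
    exact variance_le_expectation_sq hXm.aestronglyMeasurable

/-- If the workload is balanced and has downward jumps, it also has upward jumps, so that some
supply class is not connected to `D`. -/
lemma supplyOf_compl_nonempty {P : Measure Ω} [IsProbabilityMeasure P]
    {E 𝒜 : Set (𝒟 × 𝒮)} {D : Set 𝒟} {A : ℕ → Ω → EuclideanSpace ℝ (𝒟 ⊕ 𝒮)}
    (hA : IsArrivalProcess P 𝒜 A)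
    (h : 0 < P.real ((fun ω => dot (xi E D) (A 0 ω)) ⁻¹' {1})) :
    (supplyOf E D)ᶜ.Nonempty := by
  classical
  rw [Set.nonempty_compl]
  intro huniv
  have hnull : ∀ᵐ ω ∂P, ω ∉ (fun ω => dot (xi E D) (A 0 ω)) ⁻¹' {1} := by
    refine (hA.mem_arrivalSet 0).mono fun ω hω => ?_
    obtain ⟨i, j, -, hij⟩ := hω
    have h1 : dot (xi E D) (A 0 ω) = xi E D (Sum.inl i) + xi E D (Sum.inr j) := by
      rw [hij]
      simp [dot, mul_add, Finset.sum_add_distrib]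
    have h2 : xi E D (Sum.inr j) = -1 := by simp [xi, huniv]
    have h3 : xi E D (Sum.inl i) ≤ 1 := by simp only [xi]; split_ifs <;> norm_num
    simp only [Set.mem_preimage, Set.mem_singleton_iff]
    linarith
  have h0 : P ((fun ω => dot (xi E D) (A 0 ω)) ⁻¹' {1}) = 0 := measure_eq_zero_iff_ae_notMem.2 hnull
  simp [measureReal_def, h0] at h

end BipartiteMatching

end

/-! ### Assembly of the uniform bound -/

theorem lemmat {𝒟 𝒮 Ω : Type*} [Fintype 𝒟] [Fintype 𝒮] [MeasurableSpace Ω]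
    (P : Measure Ω) [IsProbabilityMeasure P]
    (E 𝒜 : Set (𝒟 × 𝒮)) (c : 𝒟 ⊕ 𝒮 → ℝ) (hc : ∀ k, 0 < c k)
    (D : Set 𝒟) (hD : D.Nonempty) (hD' : D ≠ Set.univ)
    (δmax : ℝ) (hδmax : δmax ∈ Set.Ioo (0 : ℝ) 1)
    (A : ℝ → ℕ → Ω → EuclideanSpace ℝ (𝒟 ⊕ 𝒮))
    (hA : ∀ δ ∈ Set.Icc 0 δmax, BipartiteMatching.IsArrivalProcess P 𝒜 (A δ))
    (hA1 : BipartiteMatching.AssumptionA1 P E D δmax A)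
    (hA2 : BipartiteMatching.AssumptionA2 P δmax A)
    (hA3 : BipartiteMatching.AssumptionA3 P E D δmax A) :
    ∃ C : ℝ, 0 ≤ C ∧ ∀ δ ∈ Set.Ioc 0 δmax, ∀ w : ℝ,
      ENNReal.ofReal (BipartiteMatching.diffusionCost P E D c δ (A δ)) ≤
        BipartiteMatching.optimalWorkloadCost P E D c δ (A δ) w + ENNReal.ofReal C := by
  obtain ⟨-, i₀, hi₀, j₀, hj₀, ρ, hρ, hρA⟩ := hA3
  have hD'' : Dᶜ.Nonempty := ⟨j₀, hj₀⟩
  have hjump := fun δ (hδ : δ ∈ Set.Icc 0 δmax) =>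
    BipartiteMatching.jump_probabilities (hA δ hδ) (hA1.1 δ hδ) hi₀ hj₀ (hρA δ hδ 0)
  -- At `δ = 0` up and down jumps are equally likely, so upward jumps have probability at least `ρ`;
  -- for `δ > 0` this could fail.
  have h0 : (0 : ℝ) ∈ Set.Icc 0 δmax := ⟨le_rfl, hδmax.1.le⟩
  have hS' : (BipartiteMatching.supplyOf E D)ᶜ.Nonempty := by
    obtain ⟨h1, h2, -⟩ := hjump 0 h0
    exact BipartiteMatching.supplyOf_compl_nonempty (hA 0 h0) (by linarith)
  have hb := BipartiteMatching.cMinus_pos (E := E) hc hD''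
  have ha := BipartiteMatching.cPlus_nonneg (E := E) (D := D) hc
  set a := BipartiteMatching.cPlus E D c with ha_def
  set b := BipartiteMatching.cMinus E D c with hb_def
  set L := Real.log (1 + a / b) with hL
  have hL0 : 0 ≤ L := Real.log_nonneg (by have := div_nonneg ha hb.le; linarith)
  have hs : 0 ≤ L / ρ + 2 := by positivity
  -- The `4` collects the shift `2`, one unit for rounding `T`, and one for the floor of the
  -- workload.
  refine ⟨(L / ρ + 4) * b, mul_nonneg (by linarith) hb.le, fun δ hδ w => ?_⟩
  have hδ' : δ ∈ Set.Icc 0 δmax := ⟨hδ.1.le, hδ.2⟩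
  obtain ⟨h1, h2, h3, h4⟩ := hjump δ hδ'
  rw [h1] at h2 h3 h4
  have hdef : BipartiteMatching.diffusionCost P E D c δ (A δ) = 1 / 2 *
      (variance (BipartiteMatching.disturbance E D δ (A δ) 0) P / δ) * L * b := rfl
  rw [hdef]
  rcases BipartiteMatching.exists_level hδ.1 hρ h2 h3 (variance_nonneg _ _) h4
    ha hb with h | ⟨hp, T, hT, h⟩
  · refine le_trans (ENNReal.ofReal_le_ofReal ?_) le_add_self
    exact mul_le_mul_of_nonneg_right (by linarith) hb.le
  · have hopt := BipartiteMatching.le_optimalWorkloadCost hc hD hD'' ⟨i₀, hi₀⟩ hS' (hA δ hδ') hp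
      hδ.1 rfl h1 hT w
    refine le_trans ?_ (add_le_add_left hopt _)
    refine le_trans (ENNReal.ofReal_le_ofReal ?_) ENNReal.ofReal_add_le
    have := mul_le_mul_of_nonneg_right h hb.le
    linarith
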